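/- For each $N\ge 1$ let $G_1,G_2,\dots$ be i.i.d. $N\times N$ complex Ginibre matrices, normalized so that all entries are independent with law $\mathscr N_{\mathbb C}(0,1/N)$; here $\mathscr N_{\mathbb C}(0,\sigma^2)$ is the law of $X+iY$ with $X,Y$ independent real centered Gaussian variables of variance $\sigma^2/2$. A $*$-word is a finite word $w$ over the alphabet $\{G_r\}\cup\{G_r^*\}$; $G_w$ is the product of its letters, $w^*$ is obtained from $w$ by reversing the order and replacing every letter by its conjugate transpose, and $w$ is $*$-free if no letter $G_r^*$ occurs in it. The coperiod of a nonempty word is $\mathrm{cop}(w)=\max\{k : w=u^k \text{ for some word } u\}$. For $*$-words $w_1,\dots,w_k$ take $k$ oriented polygonal faces, the $j$-th with $|w_j|$ edges labelled in cyclic order by the letters of $w_j$. A pairing of all the edges is admissible if each pair consists of edges labelled $G_r$ and $G_r^*$ for some $r$. Gluing paired edges with opposite directions (start of one to end of the other) gives a closed oriented surface; the pairing is spherical if this surface is a sphere, i.e. connected with Euler characteristic $V-E+F=2$. Let $a_w$, $b_w$, $c_w$ be the numbers of spherical admissible pairings of the faces of $(w)$, of $(w,w^*)$ and of $(w,w)$,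 respectively. Then for every nonempty $*$-free word $w$, $$\mathrm{Tr}(G_w)\xrightarrow[N\to\infty]{d}\mathscr N_{\mathbb C}(0,\mathrm{cop}(w)),$$ and moreover $a_w=c_w=0$ and $b_w=\mathrm{cop}(w)$. -/

import Mathlib

open MeasureTheory ProbabilityTheory Filter
open scoped NNReal Topology Matrix

namespace GinibreWords

/-! ### Words -/

/-- A letter of a `*`-word: `⟨r, false⟩` stands for `G_r`, and `⟨r, true⟩` for `G_r^*`. -/
structure Letter where
  index : ℕ
  starred : Bool

/-- A `*`-word is a finite sequence of letters. -/
abbrev StarWord : Type := List Letter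

/-- `G_r ↦ G_r^*` and `G_r^* ↦ G_r`. -/
def Letter.adjoint (x : Letter) : Letter := ⟨x.index, !x.starred⟩

/-- The word `w^*`: reverse the order and take the adjoint of every letter. -/
def adjointWord (w : StarWord) : StarWord := (w.map Letter.adjoint).reverse

/-- A word is `*`-free if none of its letters is a `G_r^*`. -/
def IsStarFree (w : StarWord) : Prop := ∀ x ∈ w, x.starred = false

/-- The `k`-th power of a word, that is the concatenation of `k` copies of it. -/
def wordPow (u : StarWord) (k : ℕ) : StarWord := (List.replicate k u).flatten

/-- The coperiod of a (nonempty) word: the largest `k` such that `w` is a `k`-th power.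
For nonempty `w`, the set below contains `1` and is bounded by the length of `w`. -/
noncomputable def coperiod (w : StarWord) : ℕ := sSup {k : ℕ | ∃ u : StarWord, w = wordPow u k}

/-! ### Ginibre matrices -/

/-- `N_ℂ(0, v)`: the law of `X + iY` with `X`, `Y` independent real centred Gaussian variables
of variance `v / 2`. -/
noncomputable def complexGaussian (v : ℝ≥0) : Measure ℂ :=
  ((gaussianReal 0 (v / 2)).prod (gaussianReal 0 (v / 2))).map (fun p : ℝ × ℝ => ⟨p.1, p.2⟩)

instance isProbabilityMeasure_complexGaussian (v : ℝ≥0) :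
    IsProbabilityMeasure (complexGaussian v) :=
  Measure.isProbabilityMeasure_map Complex.measurableEquivRealProd.symm.measurable.aemeasurable

/-- `G 0, G 1, …` are i.i.d. `N × N` complex Ginibre matrices whose entries have variance `1 / N`:
all the entries of all the matrices are independent and `N_ℂ(0, 1 / N)`-distributed. -/
structure IsGinibreSequence {Ω : Type*} [MeasurableSpace Ω] {N : ℕ}
    (G : ℕ → Ω → Matrix (Fin N) (Fin N) ℂ) (P : Measure Ω) : Prop where
  indep : iIndepFun (fun (q : ℕ × Fin N × Fin N) (ω : Ω) => G q.1 ω q.2.1 q.2.2) P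
  law : ∀ (r : ℕ) (i j : Fin N),
    HasLaw (fun ω => G r ω i j) (complexGaussian ((N : ℝ≥0)⁻¹)) P

/-- The matrix that a letter stands for, given the values of the matrices `G_r`. -/
def letterMatrix {N : ℕ} (G : ℕ → Matrix (Fin N) (Fin N) ℂ) (x : Letter) :
    Matrix (Fin N) (Fin N) ℂ :=
  if x.starred then (G x.index)ᴴ else G x.index

/-- The matrix `G_w`: the product of the letters of `w`, in order. -/
def wordMatrix {N : ℕ} (G : ℕ → Matrix (Fin N) (Fin N) ℂ) (w : StarWord) :
    Matrix (Fin N) (Fin N) ℂ :=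
  (w.map (letterMatrix G)).prod

/-! ### Pairings of polygonal faces -/

variable {k : ℕ}

/-- The edges of the polygonal faces `f_{w_1}, …, f_{w_k}`: the face `f_{w_j}` has one edge for each
letter of `w_j`. The same type indexes the corners of the faces: the corner `⟨j, l⟩` is the one from
which the edge `⟨j, l⟩` starts when the face is traversed in the direct way. -/
abbrev Edge (ws : Fin k → StarWord) : Type := (j : Fin k) × Fin (ws j).length

/-- The letter that labels an edge. -/
def label (ws : Fin k → StarWord) (e : Edge ws) : Letter := (ws e.1).get e.2

/-- The edge following a given edge around its face, in cyclic order. As a corner, it is the one at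
which the given edge ends. -/
def next (ws : Fin k → StarWord) : Equiv.Perm (Edge ws) :=
  Equiv.sigmaCongrRight fun j => finRotate (ws j).length

/-- Admissible pairings of the edges, as involutions: paired edges have the same index and opposite
signs. In particular no edge is paired with itself. -/
def IsAdmissible (ws : Fin k → StarWord) (φ : Equiv.Perm (Edge ws)) : Prop :=
  (∀ e, φ (φ e) = e) ∧
    ∀ e, (label ws (φ e)).index = (label ws e).index ∧
      (label ws (φ e)).starred ≠ (label ws e).starred

/-- The vertices of the graph drawn on the glued surface: paired edges are glued with
opposite directions of traversal, so that the start of `e` is identified with the end of `φ e`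
(and, applying this to `φ e`, the end of `e` with the start of `φ e`). -/
def GluedVertex (ws : Fin k → StarWord) (φ : Equiv.Perm (Edge ws)) : Type :=
  Quot fun e f : Edge ws => f = next ws (φ e)

/-- The edges of the graph drawn on the glued surface: every edge is identified with its partner. -/
def GluedEdge (ws : Fin k → StarWord) (φ : Equiv.Perm (Edge ws)) : Type :=
  Quot fun e f : Edge ws => f = φ e

/-- The connected components of the glued surface: faces are identified when an edge of the one is
paired with an edge of the other. -/
def GluedComponent (ws : Fin k → StarWord) (φ : Equiv.Perm (Edge ws)) : Type :=
  Quot fun i j : Fin k => ∃ e : Edge ws, e.1 = i ∧ (φ e).1 = j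

/-- The Euler characteristic `V - E + F` of the glued surface. -/
noncomputable def eulerChar (ws : Fin k → StarWord) (φ : Equiv.Perm (Edge ws)) : ℤ :=
  (Nat.card (GluedVertex ws φ) : ℤ) - (Nat.card (GluedEdge ws φ) : ℤ) + (k : ℤ)

/-- The glued surface, which is closed and oriented when `φ` is admissible, is a sphere: it is
connected, and its genus `g`, determined by `2 - 2 g = V - E + F`, is zero. -/
def IsSpherical (ws : Fin k → StarWord) (φ : Equiv.Perm (Edge ws)) : Prop :=
  Nat.card (GluedComponent ws φ) = 1 ∧ eulerChar ws φ = 2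

/-- The number of spherical admissible pairings of the faces `f_{w_1}, …, f_{w_k}`. -/
noncomputable def numSpherical (ws : Fin k → StarWord) : ℕ :=
  Nat.card {φ : Equiv.Perm (Edge ws) // IsAdmissible ws φ ∧ IsSpherical ws φ}

/-- `a_w`: the number of spherical admissible pairings of `w`. -/
noncomputable def aCount (w : StarWord) : ℕ := numSpherical ![w]

/-- `b_w`: the number of spherical admissible pairings of `w` and `w^*`. -/
noncomputable def bCount (w : StarWord) : ℕ := numSpherical ![w, adjointWord w]

/-- `c_w`: the number of spherical admissible pairings of two copies of `w`. -/
noncomputable def cCount (w : StarWord) : ℕ := numSpherical ![w, w]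

end GinibreWords

/-! The convergence is proved by moments. Expand `Tr(G_w)` as a sum over closed index paths. By
Wick's formula, a mixed moment with `a` factors and `b` conjugate factors is a sum over
label-preserving bijections σ from the edges of `a` copies of `w` to those of `b` copies. Given σ,
the path on the second side fixes the one on the first and must still satisfy a closing condition.
Full freedom of the indices exactly cancels the weight `N⁻¹` per edge, and any nontrivial condition
costs a factor `N`. Hence the limit counts the σ that commute with the cyclic rotation
(`tendsto_integral_path_sum`). Such a σ permutes the copies and rotates each one by a period of `w`,
so the count is `a! cop(w)^a` if `a = b` and `0` otherwise (`card_labelledEquiv`,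
`card_period_index`). These are the mixed moments of the complex Gaussian of variance `cop(w)`,
whose slow growth gives convergence in law (`tendsto_of_tendsto_moments`).

The counts `a_w` and `c_w` vanish because no edge is starred. For `(w, w^*)` every pair joins the
two faces, so with `n = |w|` there are `n` glued edges, two faces and `2n` corners. The surface is a
sphere iff `V = n`. A vertex is an orbit of `next ∘ φ`, which has no fixed point, so `V = n` means
that all vertices have degree two (`IsAdmissible.isSpherical_iff`). This forces φ to be a rotation,
and admissibility makes the rotation a period (`eq_rotationPairing`). -/

namespace GinibreWords

/-! ### Moments of the complex Gaussian law -/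

/-- The real exponent in `‖z‖ ^ (2 : ℝ)` matches `Complex.integral_rpow_mul_exp_neg_mul_rpow`, which
supplies all radial moments. -/
lemma complexGaussian_eq_withDensity {v : ℝ≥0} (hv : v ≠ 0) :
    complexGaussian v = (volume : Measure ℂ).withDensity
      (fun z => ENNReal.ofReal ((Real.pi * v)⁻¹ * Real.exp (-(v : ℝ)⁻¹ * ‖z‖ ^ (2 : ℝ)))) := by
  have hv2 : v / 2 ≠ 0 := by positivity
  have hmp := Complex.volume_preserving_equiv_real_prod.symm Complex.measurableEquivRealProd
  unfold complexGaussian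
  rw [gaussianReal_of_var_ne_zero _ hv2, prod_withDensity (by fun_prop) (by fun_prop),
    ← Measure.volume_eq_prod]
  change Measure.map Complex.measurableEquivRealProd.symm _ = _
  ext s hs
  rw [Measure.map_apply Complex.measurableEquivRealProd.symm.measurable hs,
    withDensity_apply _ hs,
    withDensity_apply _ (Complex.measurableEquivRealProd.symm.measurable hs),
    ← hmp.setLIntegral_comp_preimage hs (by fun_prop)]
  refine lintegral_congr fun p => ?_
  have hn : ‖Complex.measurableEquivRealProd.symm p‖ ^ (2 : ℝ) = p.1 ^ 2 + p.2 ^ 2 := by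
    rw [Real.rpow_two, ← Complex.normSq_eq_norm_sq, Complex.normSq_apply]
    simp [sq]
  rw [gaussianPDF, gaussianPDF, ← ENNReal.ofReal_mul (gaussianPDFReal_nonneg _ _ _), hn]
  congr 1
  have hv' : (0 : ℝ) < v := by positivity
  simp only [gaussianPDFReal, NNReal.coe_div, NNReal.coe_ofNat, sub_zero]
  rw [mul_mul_mul_comm, ← Real.exp_add, ← mul_inv, Real.mul_self_sqrt (by positivity)]
  congr 2
  · field_simp
  · field_simp
    ring

lemma integral_complexGaussian {v : ℝ≥0} (hv : v ≠ 0) (f : ℂ → ℂ) :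
    ∫ z, f z ∂complexGaussian v =
      ∫ z, ((Real.pi * v)⁻¹ * Real.exp (-(v : ℝ)⁻¹ * ‖z‖ ^ (2 : ℝ)) : ℝ) • f z := by
  rw [complexGaussian_eq_withDensity hv, integral_withDensity_eq_integral_toReal_smul
    (by fun_prop) (by simp)]
  refine integral_congr_ae (ae_of_all _ fun z => ?_)
  simp only
  rw [ENNReal.toReal_ofReal (by positivity)]

lemma integral_norm_pow_mul_exp {v : ℝ≥0} (hv : v ≠ 0) (k : ℕ) :
    ∫ z : ℂ, ‖z‖ ^ k * Real.exp (-(v : ℝ)⁻¹ * ‖z‖ ^ (2 : ℝ)) =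
      Real.pi * (v : ℝ)⁻¹ ^ (-((k : ℝ) + 2) / 2) * Real.Gamma (((k : ℝ) + 2) / 2) := by
  have h := Complex.integral_rpow_mul_exp_neg_mul_rpow (p := 2) (q := k) (b := (v : ℝ)⁻¹)
    (by norm_num) (by linarith [(Nat.cast_nonneg k : (0 : ℝ) ≤ k)]) (by positivity)
  simp only [Real.rpow_natCast] at h
  rw [h]
  ring

lemma integrable_norm_pow_complexGaussian {v : ℝ≥0} (hv : v ≠ 0) (k : ℕ) :
    Integrable (fun z : ℂ => ‖z‖ ^ k) (complexGaussian v) := by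
  have h : Integrable
      (fun z : ℂ => ‖z‖ ^ k * Real.exp (-(v : ℝ)⁻¹ * ‖z‖ ^ (2 : ℝ))) := by
    -- A non-integrable function would have Bochner integral `0`, whereas the known value is
    -- positive.
    by_contra hc
    have h1 := integral_norm_pow_mul_exp hv k
    rw [integral_undef hc] at h1
    have : 0 < Real.Gamma (((k : ℝ) + 2) / 2) := Real.Gamma_pos_of_pos (by positivity)
    have hv' : (0 : ℝ) < v := by positivity
    have : 0 < Real.pi * (v : ℝ)⁻¹ ^ (-((k : ℝ) + 2) / 2) * Real.Gamma (((k : ℝ) + 2) / 2) := by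
      positivity
    linarith
  rw [complexGaussian_eq_withDensity hv, integrable_withDensity_iff (by fun_prop) (by simp)]
  refine (h.const_mul ((Real.pi * v)⁻¹)).congr (ae_of_all _ fun z => ?_)
  simp only
  rw [ENNReal.toReal_ofReal (by positivity)]
  ring

lemma integral_norm_pow_complexGaussian {v : ℝ≥0} (hv : v ≠ 0) (a : ℕ) :
    ∫ z : ℂ, ((‖z‖ ^ (2 * a) : ℝ) : ℂ) ∂complexGaussian v = (a.factorial : ℂ) * (v : ℂ) ^ a := by
  rw [integral_complexGaussian hv]
  have hv' : (0 : ℝ) < v := by positivity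
  have h1 : ∀ z : ℂ, ((Real.pi * v)⁻¹ * Real.exp (-(v : ℝ)⁻¹ * ‖z‖ ^ (2 : ℝ)) : ℝ) •
      ((‖z‖ ^ (2 * a) : ℝ) : ℂ) = (((Real.pi * v)⁻¹ *
        (‖z‖ ^ (2 * a) * Real.exp (-(v : ℝ)⁻¹ * ‖z‖ ^ (2 : ℝ))) : ℝ) : ℂ) := by
    intro z
    rw [Complex.real_smul, ← Complex.ofReal_mul]
    congr 1
    ring
  simp_rw [h1]
  rw [integral_complex_ofReal, integral_const_mul, integral_norm_pow_mul_exp hv]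
  have h2 : ((2 * a : ℕ) + 2 : ℝ) / 2 = a + 1 := by push_cast; ring
  have h3 : -((2 * a : ℕ) + 2 : ℝ) / 2 = -((a + 1 : ℕ) : ℝ) := by push_cast; ring
  rw [h2, h3, Real.Gamma_nat_eq_factorial, Real.rpow_neg (by positivity), Real.rpow_natCast]
  have h4 : (Real.pi * v)⁻¹ * (Real.pi * (((v : ℝ)⁻¹ ^ (a + 1))⁻¹) * a.factorial) =
      a.factorial * (v : ℝ) ^ a := by
    have := Real.pi_pos
    rw [inv_pow, inv_inv, pow_succ]
    field_simp
  rw [h4]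
  push_cast
  rfl

/-- The law is rotation invariant. A rotation `u` with `u ^ (a - b) = -1`, by the angle `π / (a -
b)`, shows that the integral equals its own negative. -/
lemma integral_pow_mul_conj_pow_complexGaussian_of_ne {v : ℝ≥0} (hv : v ≠ 0) {a b : ℕ}
    (hab : a ≠ b) :
    ∫ z : ℂ, z ^ a * (starRingEnd ℂ z) ^ b ∂complexGaussian v = 0 := by
  obtain ⟨u, hu⟩ : ∃ u : Circle, (u : ℂ) ^ a * (starRingEnd ℂ (u : ℂ)) ^ b = -1 := by
    have hd : ((a : ℂ) - b) ≠ 0 := sub_ne_zero.2 (by exact_mod_cast hab)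
    refine ⟨Circle.exp (Real.pi / ((a : ℝ) - b)), ?_⟩
    rw [Circle.coe_exp, ← Complex.exp_conj, ← Complex.exp_nat_mul, ← Complex.exp_nat_mul,
      ← Complex.exp_add, ← Complex.exp_pi_mul_I]
    congr 1
    simp only [map_mul, Complex.conj_I, Complex.conj_ofReal]
    push_cast
    field_simp
    ring
  rw [integral_complexGaussian hv]
  set f : ℂ → ℂ := fun z => ((Real.pi * v)⁻¹ * Real.exp (-(v : ℝ)⁻¹ * ‖z‖ ^ (2 : ℝ)) : ℝ) •
    (z ^ a * (starRingEnd ℂ z) ^ b) with hf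
  have hmp := (rotation u).measurePreserving
  have h1 : ∫ z, f (rotation u z) = ∫ z, f z :=
    hmp.integral_comp (rotation u).toHomeomorph.measurableEmbedding f
  have h2 : ∀ z, f (rotation u z) = - f z := by
    intro z
    have : ((u : ℂ) * z) ^ a * (starRingEnd ℂ ((u : ℂ) * z)) ^ b =
        -(z ^ a * (starRingEnd ℂ z) ^ b) := by
      rw [map_mul, mul_pow, mul_pow, mul_mul_mul_comm, hu, neg_one_mul]
    simp only [hf, rotation_apply, this, norm_mul, Circle.norm_coe, one_mul, smul_neg]
  simp_rw [h2] at h1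
  rw [integral_neg] at h1
  exact self_eq_neg.1 h1.symm

lemma integral_pow_mul_conj_pow_complexGaussian {v : ℝ≥0} (hv : v ≠ 0) (a b : ℕ) :
    ∫ z : ℂ, z ^ a * (starRingEnd ℂ z) ^ b ∂complexGaussian v =
      if a = b then (a.factorial : ℂ) * (v : ℂ) ^ a else 0 := by
  split_ifs with hab
  · subst hab
    rw [← integral_norm_pow_complexGaussian hv]
    refine integral_congr_ae (ae_of_all _ fun z => ?_)
    simp only
    rw [← mul_pow, Complex.mul_conj, Complex.normSq_eq_norm_sq, pow_mul]
    push_cast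
    rfl
  · exact integral_pow_mul_conj_pow_complexGaussian_of_ne hv hab

/-! ### Convergence in law from convergence of mixed moments -/

/-- The derivative of a Taylor remainder is `I` times the preceding remainder, so the bound
propagates by integrating it from `0`. -/
lemma norm_exp_mul_I_sub_sum_le_of_nonneg (n : ℕ) : ∀ x : ℝ, 0 ≤ x →
    ‖Complex.exp (x * Complex.I) - ∑ k ∈ Finset.range n, (x * Complex.I) ^ k / k.factorial‖ ≤
      x ^ n / n.factorial := by
  induction n with
  | zero => intro x _; simp [Complex.norm_exp_ofReal_mul_I]
  | succ n ih =>
    intro x hx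
    have hd : ∀ y : ℝ, HasDerivAt (fun y : ℝ => Complex.exp (y * Complex.I) -
        ∑ k ∈ Finset.range (n + 1), (y * Complex.I) ^ k / k.factorial)
        ((Complex.exp (y * Complex.I) -
          ∑ k ∈ Finset.range n, (y * Complex.I) ^ k / k.factorial) * Complex.I) y := by
      intro y
      have h0 : HasDerivAt (fun y : ℝ => (y : ℂ) * Complex.I) Complex.I y := by
        simpa using (Complex.ofRealCLM.hasDerivAt (x := y)).mul_const Complex.I
      rw [sub_mul, Finset.sum_mul]
      refine h0.cexp.sub ?_
      have h1 : ∀ k ∈ Finset.range (n + 1), HasDerivAt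
          (fun y : ℝ => ((y : ℂ) * Complex.I) ^ k / k.factorial)
          (k * ((y : ℂ) * Complex.I) ^ (k - 1) * Complex.I / k.factorial) y :=
        fun k _ => (h0.pow k).div_const _
      convert HasDerivAt.fun_sum h1 using 1
      rw [Finset.sum_range_succ']
      simp only [Nat.cast_zero, zero_mul, zero_div, add_zero, Nat.add_sub_cancel]
      refine Finset.sum_congr rfl fun k _ => ?_
      have : (k.factorial : ℂ) ≠ 0 := by exact_mod_cast k.factorial_ne_zero
      have : ((k : ℂ) + 1) ≠ 0 := by exact_mod_cast k.succ_ne_zero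
      rw [Nat.factorial_succ]
      push_cast
      field_simp
    have hB : ∀ y : ℝ, HasDerivAt (fun y : ℝ => y ^ (n + 1) / (n + 1).factorial)
        (y ^ n / n.factorial) y := by
      intro y
      refine ((hasDerivAt_pow (n + 1) y).div_const ((n + 1).factorial : ℝ)).congr_deriv ?_
      rw [Nat.factorial_succ]
      push_cast
      have : (n.factorial : ℝ) ≠ 0 := by exact_mod_cast n.factorial_ne_zero
      have : ((n : ℝ) + 1) ≠ 0 := by positivity
      field_simp
    refine image_norm_le_of_norm_deriv_right_le_deriv_boundary (a := 0) (b := x)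
      (fun y _ => (hd y).continuousAt.continuousWithinAt)
      (fun y _ => (hd y).hasDerivWithinAt) ?_ hB ?_ (Set.right_mem_Icc.2 hx)
    · simp [Finset.sum_range_succ']
    · intro y hy
      rw [norm_mul, Complex.norm_I, mul_one]
      exact ih y hy.1

lemma norm_exp_mul_I_sub_sum_le (n : ℕ) (x : ℝ) :
    ‖Complex.exp (x * Complex.I) - ∑ k ∈ Finset.range n, (x * Complex.I) ^ k / k.factorial‖ ≤
      |x| ^ n / n.factorial := by
  rcases le_total 0 x with hx | hx
  · rw [abs_of_nonneg hx]
    exact norm_exp_mul_I_sub_sum_le_of_nonneg n x hx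
  · rw [abs_of_nonpos hx]
    refine le_of_eq_of_le ?_ (norm_exp_mul_I_sub_sum_le_of_nonneg n (-x) (neg_nonneg.2 hx))
    rw [← Complex.norm_conj, map_sub, map_sum, ← Complex.exp_conj]
    simp

lemma integrable_pow_mul_conj_pow {μ : Measure ℂ}
    (hint : ∀ k : ℕ, Integrable (fun z : ℂ => ‖z‖ ^ k) μ) (a b : ℕ) :
    Integrable (fun z : ℂ => z ^ a * (starRingEnd ℂ z) ^ b) μ := by
  refine (hint (a + b)).mono' (by fun_prop) (ae_of_all _ fun z => ?_)
  simp [pow_add]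

/-- The real moments of the linear functional `⟪·, t⟫` in terms of the mixed moments. -/
lemma integral_inner_pow {μ : Measure ℂ}
    (hint : ∀ k : ℕ, Integrable (fun z : ℂ => ‖z‖ ^ k) μ) (t : ℂ) (k : ℕ) :
    ∫ z : ℂ, ((inner ℝ z t : ℝ) * Complex.I) ^ k ∂μ =
      ∑ m ∈ Finset.range (k + 1), ((Complex.I / 2) ^ k * (starRingEnd ℂ t) ^ m * t ^ (k - m) *
        (k.choose m)) * ∫ z : ℂ, z ^ m * (starRingEnd ℂ z) ^ (k - m) ∂μ := by
  have h : ∀ z : ℂ, ((inner ℝ z t : ℝ) * Complex.I) ^ k =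
      ∑ m ∈ Finset.range (k + 1), ((Complex.I / 2) ^ k * (starRingEnd ℂ t) ^ m * t ^ (k - m) *
        (k.choose m)) * (z ^ m * (starRingEnd ℂ z) ^ (k - m)) := by
    intro z
    have h1 : ((inner ℝ z t : ℝ) : ℂ) =
        (z * starRingEnd ℂ t + starRingEnd ℂ z * t) / 2 := by
      apply Complex.ext <;> simp [Complex.inner] <;> ring
    rw [h1, div_mul_eq_mul_div, mul_div_assoc, mul_pow, add_pow, Finset.sum_mul]
    refine Finset.sum_congr rfl fun m _ => ?_
    rw [mul_pow, mul_pow]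
    ring
  simp_rw [h]
  rw [integral_finsetSum _ fun m _ => (integrable_pow_mul_conj_pow hint _ _).const_mul _]
  simp_rw [integral_const_mul]

lemma integrable_inner_pow {μ : Measure ℂ}
    (hint : ∀ k : ℕ, Integrable (fun z : ℂ => ‖z‖ ^ k) μ) (t : ℂ) (k : ℕ) :
    Integrable (fun z : ℂ => ((inner ℝ z t : ℝ) * Complex.I) ^ k) μ := by
  refine ((hint k).mul_const (‖t‖ ^ k)).mono' (by fun_prop) (ae_of_all _ fun z => ?_)
  rw [norm_pow, norm_mul, Complex.norm_I, mul_one, Complex.norm_real, ← mul_pow]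
  exact pow_le_pow_left₀ (norm_nonneg _) (norm_inner_le_norm _ _) _

lemma norm_charFun_sub_sum_le {μ : Measure ℂ} [IsProbabilityMeasure μ]
    (hint : ∀ k : ℕ, Integrable (fun z : ℂ => ‖z‖ ^ k) μ) (t : ℂ) (n : ℕ) :
    ‖charFun μ t - ∑ k ∈ Finset.range n,
        (∫ z : ℂ, ((inner ℝ z t : ℝ) * Complex.I) ^ k ∂μ) / k.factorial‖ ≤
      (∫ z : ℂ, ‖z‖ ^ n ∂μ) * (‖t‖ ^ n / n.factorial) := by
  have hexp : Integrable (fun z : ℂ => Complex.exp ((inner ℝ z t : ℝ) * Complex.I)) μ := by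
    refine (integrable_const (1 : ℝ)).mono' (by fun_prop) (ae_of_all _ fun z => ?_)
    rw [Complex.norm_exp_ofReal_mul_I]
  simp_rw [← integral_div]
  rw [charFun_apply, ← integral_finsetSum _ fun k _ => (integrable_inner_pow hint t k).div_const _,
    ← integral_sub hexp (integrable_finsetSum _ fun k _ =>
      (integrable_inner_pow hint t k).div_const _), ← integral_mul_const]
  refine norm_integral_le_of_norm_le ((hint n).mul_const _) (ae_of_all _ fun z => ?_)
  refine (norm_exp_mul_I_sub_sum_le n _).trans ?_
  rw [← mul_div_assoc, ← mul_pow]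
  gcongr
  exact abs_real_inner_le_norm z t

lemma integral_norm_pow_two_mul {μ : Measure ℂ} (m : ℕ) :
    ((∫ z : ℂ, ‖z‖ ^ (2 * m) ∂μ : ℝ) : ℂ) = ∫ z : ℂ, z ^ m * (starRingEnd ℂ z) ^ m ∂μ := by
  rw [← integral_complex_ofReal]
  refine integral_congr_ae (ae_of_all _ fun z => ?_)
  simp only
  rw [← mul_pow, Complex.mul_conj, Complex.normSq_eq_norm_sq, pow_mul]
  push_cast
  rfl

/-- Convergence of all mixed moments implies convergence in law, if the absolute moments of the
limit do not grow too fast. -/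
theorem tendsto_of_tendsto_moments {μ : ℕ → ProbabilityMeasure ℂ} {ν : ProbabilityMeasure ℂ}
    (hμ : ∀ N, ∀ k : ℕ, Integrable (fun z : ℂ => ‖z‖ ^ k) (μ N : Measure ℂ))
    (hν : ∀ k : ℕ, Integrable (fun z : ℂ => ‖z‖ ^ k) (ν : Measure ℂ))
    (hmom : ∀ a b : ℕ, Tendsto (fun N => ∫ z : ℂ, z ^ a * (starRingEnd ℂ z) ^ b ∂(μ N : Measure ℂ))
      atTop (𝓝 (∫ z : ℂ, z ^ a * (starRingEnd ℂ z) ^ b ∂(ν : Measure ℂ))))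
    (hgrow : ∀ r : ℝ, Tendsto (fun m : ℕ => (∫ z : ℂ, ‖z‖ ^ (2 * m) ∂(ν : Measure ℂ)) *
      (r ^ (2 * m) / (2 * m).factorial)) atTop (𝓝 0)) :
    Tendsto μ atTop (𝓝 ν) := by
  rw [ProbabilityMeasure.tendsto_iff_tendsto_charFun]
  intro t
  rw [Metric.tendsto_atTop']
  intro ε hε
  -- The even order `2 * m` matters: `‖z‖ ^ (2 * m)` is itself a mixed moment, so the Taylor error
  -- for `μ N` converges to that for `ν` and is also eventually below `ε / 4`.
  obtain ⟨m, hm⟩ := ((hgrow ‖t‖).eventually (gt_mem_nhds (by positivity : 0 < ε / 4))).exists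
  set S : Measure ℂ → ℂ := fun ρ => ∑ k ∈ Finset.range (2 * m),
    (∫ z : ℂ, ((inner ℝ z t : ℝ) * Complex.I) ^ k ∂ρ) / k.factorial with hS
  have hSlim : Tendsto (fun N => S (μ N)) atTop (𝓝 (S ν)) := by
    refine tendsto_finsetSum _ fun k _ => Tendsto.div_const ?_ _
    simp_rw [integral_inner_pow (hμ _), integral_inner_pow hν]
    exact tendsto_finsetSum _ fun j _ => (hmom _ _).const_mul _
  have hBlim : Tendsto (fun N => (∫ z : ℂ, ‖z‖ ^ (2 * m) ∂(μ N : Measure ℂ)) *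
      (‖t‖ ^ (2 * m) / (2 * m).factorial)) atTop
      (𝓝 ((∫ z : ℂ, ‖z‖ ^ (2 * m) ∂(ν : Measure ℂ)) *
        (‖t‖ ^ (2 * m) / (2 * m).factorial))) := by
    refine Tendsto.mul_const _ ?_
    have h := hmom m m
    simp_rw [← integral_norm_pow_two_mul] at h
    exact (Complex.continuous_re.tendsto _).comp h
  have h1 := hBlim.eventually (gt_mem_nhds hm)
  have h2 := hSlim.eventually (Metric.ball_mem_nhds _ (by positivity : 0 < ε / 4))
  obtain ⟨N₀, hN₀⟩ := eventually_atTop.1 (h1.and h2)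
  refine ⟨N₀, fun N hN => ?_⟩
  obtain ⟨hN1, hN2⟩ := hN₀ N hN.le
  have e1 := norm_charFun_sub_sum_le (hμ N) t (2 * m)
  have e2 := norm_charFun_sub_sum_le hν t (2 * m)
  rw [dist_eq_norm] at hN2 ⊢
  have e3 : charFun (μ N : Measure ℂ) t - charFun (ν : Measure ℂ) t =
      (charFun (μ N : Measure ℂ) t - S (μ N)) + (S (μ N) - S ν) -
        (charFun (ν : Measure ℂ) t - S ν) := by ring
  rw [e3]
  have e4 := norm_sub_le ((charFun (μ N : Measure ℂ) t - S (μ N)) + (S (μ N) - S ν))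
    (charFun (ν : Measure ℂ) t - S ν)
  have e5 := norm_add_le (charFun (μ N : Measure ℂ) t - S (μ N)) (S (μ N) - S ν)
  simp only [hS] at *
  linarith

lemma tendsto_moment_growth_complexGaussian {v : ℝ≥0} (hv : v ≠ 0) (r : ℝ) :
    Tendsto (fun m : ℕ => (∫ z : ℂ, ‖z‖ ^ (2 * m) ∂complexGaussian v) *
      (r ^ (2 * m) / (2 * m).factorial)) atTop (𝓝 0) := by
  have h : ∀ m : ℕ, ∫ z : ℂ, ‖z‖ ^ (2 * m) ∂complexGaussian v = m.factorial * (v : ℝ) ^ m := by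
    intro m
    have := integral_norm_pow_complexGaussian hv m
    rw [integral_complex_ofReal] at this
    exact_mod_cast this
  simp_rw [h]
  refine squeeze_zero (fun m => ?_) (fun m => ?_)
    (FloorSemiring.tendsto_pow_div_factorial_atTop ((v : ℝ) * r ^ 2))
  · rw [pow_mul]; positivity
  -- Since `m! * m! ≤ (2m)!`, the term is at most `(v r²)^m / m!`.
  · have h1 : (m.factorial * m.factorial : ℝ) ≤ (2 * m).factorial := by
      rw [two_mul]
      exact_mod_cast Nat.le_of_dvd (Nat.factorial_pos _) (Nat.factorial_mul_factorial_dvd_factorial_add m m)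
    have h2 : (0 : ℝ) < m.factorial := by exact_mod_cast m.factorial_pos
    have h3 : (0 : ℝ) < (2 * m).factorial := by exact_mod_cast (2 * m).factorial_pos
    rw [mul_pow, ← pow_mul, mul_div_assoc', div_le_div_iff₀ h3 h2]
    have h4 : 0 ≤ (v : ℝ) ^ m * r ^ (2 * m) := by rw [pow_mul]; positivity
    nlinarith [mul_le_mul_of_nonneg_left h1 h4]

/-! ### Wick's formula -/

section FiberCount

variable {A B Q : Type*} [Fintype A] [Fintype B] [DecidableEq Q]

lemma card_fiber_eq_of_comp_eq {c : A → Q} {d : B → Q} (σ : A ≃ B) (h : d ∘ σ = c) (q : Q) :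
    Fintype.card {e // c e = q} = Fintype.card {f // d f = q} :=
  Fintype.card_congr (σ.subtypeEquiv fun e => by rw [← h]; rfl)

lemma exists_equiv_of_card_fiber_eq {c : A → Q} {d : B → Q}
    (h : ∀ q, Fintype.card {e // c e = q} = Fintype.card {f // d f = q}) :
    ∃ σ : A ≃ B, d ∘ σ = c := by
  have e : ∀ q, {e // c e = q} ≃ {f // d f = q} := fun q => Fintype.equivOfCardEq (h q)
  refine ⟨(Equiv.sigmaFiberEquiv c).symm.trans
    ((Equiv.sigmaCongrRight e).trans (Equiv.sigmaFiberEquiv d)), ?_⟩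
  ext a
  exact (e (c a) ⟨a, rfl⟩).2

/-- The number of bijections matching two colourings is the product of the factorials of the sizes
of the fibers, if these sizes agree. -/
lemma card_equiv_comp_eq [Fintype Q] (c : A → Q) (d : B → Q) :
    Nat.card {σ : A ≃ B // d ∘ σ = c} =
      ∏ q, if Fintype.card {e // c e = q} = Fintype.card {f // d f = q} then
        (Fintype.card {e // c e = q}).factorial else 0 := by
  classical
  by_cases h : ∀ q, Fintype.card {e // c e = q} = Fintype.card {f // d f = q}
  -- One matching bijection `τ` identifies all the others with the permutations preserving a
  -- colouring.
  · obtain ⟨τ, rfl⟩ := exists_equiv_of_card_fiber_eq h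
    rw [Finset.prod_congr rfl fun q _ => if_pos (h q), ← DomMulAct.stabilizer_card,
      ← Nat.card_eq_fintype_card]
    refine Nat.card_congr (Equiv.subtypeEquiv (Equiv.equivCongr (Equiv.refl A) τ.symm) fun σ => ?_)
    constructor
    · intro hσ
      ext a
      have := congrFun hσ a
      simpa using this
    · intro hσ
      ext a
      have := congrFun hσ a
      simpa using this
  · push Not at h
    obtain ⟨q, hq⟩ := h
    rw [Finset.prod_eq_zero (Finset.mem_univ q) (if_neg hq)]
    have : IsEmpty {σ : A ≃ B // d ∘ σ = c} :=
      ⟨fun σ => hq (card_fiber_eq_of_comp_eq σ.1 σ.2 q)⟩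
    exact Nat.card_of_isEmpty

lemma prod_comp_eq_prod_pow [Fintype Q] (c : A → Q) (x : Q → ℂ) :
    ∏ e, x (c e) = ∏ q, x q ^ Fintype.card {e // c e = q} := by
  rw [← Finset.prod_fiberwise (s := Finset.univ) (g := c)]
  refine Finset.prod_congr rfl fun q _ => ?_
  rw [Fintype.card_subtype, ← Finset.prod_const]
  refine Finset.prod_congr rfl fun e he => ?_
  rw [(Finset.mem_filter.1 he).2]

end FiberCount

section Wick

variable {Ω : Type*} [MeasurableSpace Ω] {P : Measure Ω}

/-- Grouping equal variables and using independence gives a product over `q`. The single-variable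
moments are exactly the factors of `card_equiv_comp_eq`, times powers of `v` whose exponents add up
to `|A|`. -/
lemma wick_fintype {A B Q : Type*} [Fintype A] [Fintype B] [Fintype Q] {v : ℝ≥0} (hv : v ≠ 0)
    {X : Q → Ω → ℂ} (hX : iIndepFun X P) (hlaw : ∀ q, HasLaw (X q) (complexGaussian v) P)
    (c : A → Q) (d : B → Q) :
    ∫ ω, (∏ e, X (c e) ω) * ∏ f, starRingEnd ℂ (X (d f) ω) ∂P =
      (v : ℂ) ^ Fintype.card A * Nat.card {σ : A ≃ B // d ∘ σ = c} := by
  classical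
  have h1 : ∀ ω, (∏ e, X (c e) ω) * ∏ f, starRingEnd ℂ (X (d f) ω) =
      ∏ q, (X q ω ^ Fintype.card {e // c e = q} *
        starRingEnd ℂ (X q ω) ^ Fintype.card {f // d f = q}) := by
    intro ω
    rw [prod_comp_eq_prod_pow c (fun q => X q ω),
      prod_comp_eq_prod_pow d (fun q => starRingEnd ℂ (X q ω)), Finset.prod_mul_distrib]
  simp_rw [h1]
  rw [hX.integral_fun_prod_comp (f := fun q z => z ^ Fintype.card {e // c e = q} *
    starRingEnd ℂ z ^ Fintype.card {f // d f = q}) (fun q => (hlaw q).aemeasurable)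
    (fun q => by fun_prop)]
  have h2 : ∀ q, ∫ ω, X q ω ^ Fintype.card {e // c e = q} *
        starRingEnd ℂ (X q ω) ^ Fintype.card {f // d f = q} ∂P =
      (v : ℂ) ^ Fintype.card {e // c e = q} *
        ((if Fintype.card {e // c e = q} = Fintype.card {f // d f = q} then
          (Fintype.card {e // c e = q}).factorial else 0 : ℕ) : ℂ) := by
    intro q
    have := (hlaw q).integral_comp (f := fun z : ℂ => z ^ Fintype.card {e // c e = q} *
      starRingEnd ℂ z ^ Fintype.card {f // d f = q}) (by fun_prop)
    simp only [Function.comp_def] at this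
    rw [this, integral_pow_mul_conj_pow_complexGaussian hv]
    split_ifs <;> simp [mul_comm]
  simp_rw [h2]
  rw [Finset.prod_mul_distrib, card_equiv_comp_eq, Nat.cast_prod, Finset.prod_pow_eq_pow_sum]
  congr 2
  rw [← Fintype.card_sigma]
  exact Fintype.card_congr (Equiv.sigmaFiberEquiv c)

/-- **Wick's formula** for a family of independent complex Gaussian variables. -/
theorem wick {A B Q : Type*} [Fintype A] [Fintype B] {v : ℝ≥0} (hv : v ≠ 0)
    {X : Q → Ω → ℂ} (hX : iIndepFun X P) (hlaw : ∀ q, HasLaw (X q) (complexGaussian v) P)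
    (c : A → Q) (d : B → Q) :
    ∫ ω, (∏ e, X (c e) ω) * ∏ f, starRingEnd ℂ (X (d f) ω) ∂P =
      (v : ℂ) ^ Fintype.card A * Nat.card {σ : A ≃ B // d ∘ σ = c} := by
  classical
  let S : Finset Q := Finset.univ.image c ∪ Finset.univ.image d
  let c' : A → S := fun e => ⟨c e, by simp [S]⟩
  let d' : B → S := fun f => ⟨d f, by simp [S]⟩
  have h := wick_fintype hv (hX.precomp (g := ((↑) : S → Q)) Subtype.val_injective)
    (fun q => hlaw q) c' d'
  rw [h]
  congr 2
  refine Nat.card_congr (Equiv.subtypeEquivRight fun σ => ?_)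
  simp [funext_iff, c', d', Subtype.ext_iff]

end Wick

/-! ### Variables with moments of all orders -/

/-- `f` has absolute moments of all orders. -/
def HasAllMoments {Ω : Type*} [MeasurableSpace Ω] (f : Ω → ℂ) (P : Measure Ω) : Prop :=
  ∀ p : ℕ, MemLp f p P

section Moments

variable {Ω : Type*} [MeasurableSpace Ω] {P : Measure Ω}

lemma HasAllMoments.mul {f g : Ω → ℂ} (hf : HasAllMoments f P) (hg : HasAllMoments g P) :
    HasAllMoments (fun ω => f ω * g ω) P := by
  intro p
  have h1 : ENNReal.HolderTriple ((2 * p : ℕ) : ENNReal) ((2 * p : ℕ) : ENNReal) (p : ENNReal) := by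
    constructor
    rcases eq_or_ne p 0 with rfl | hp
    · simp
    · push_cast
      rw [ENNReal.mul_inv (by simp) (by simp), ← add_mul, ENNReal.inv_two_add_inv_two, one_mul]
  exact (hg (2 * p)).mul (hf (2 * p))

lemma HasAllMoments.sum {ι : Type*} (s : Finset ι) {f : ι → Ω → ℂ}
    (hf : ∀ i ∈ s, HasAllMoments (f i) P) : HasAllMoments (fun ω => ∑ i ∈ s, f i ω) P :=
  fun p => memLp_finsetSum s fun i hi => hf i hi p

lemma HasAllMoments.prod [IsFiniteMeasure P] {ι : Type*} (s : Finset ι) {f : ι → Ω → ℂ}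
    (hf : ∀ i ∈ s, HasAllMoments (f i) P) : HasAllMoments (fun ω => ∏ i ∈ s, f i ω) P := by
  classical
  induction s using Finset.induction_on with
  | empty =>
    intro p
    simpa using memLp_const (1 : ℂ)
  | insert i s hi ih =>
    simp_rw [Finset.prod_insert hi]
    exact (hf i (Finset.mem_insert_self _ _)).mul
      (ih fun j hj => hf j (Finset.mem_insert_of_mem hj))

lemma HasAllMoments.conj {f : Ω → ℂ} (hf : HasAllMoments f P) :
    HasAllMoments (fun ω => starRingEnd ℂ (f ω)) P :=
  fun p => (hf p).star

lemma HasAllMoments.integrable {f : Ω → ℂ} (hf : HasAllMoments f P) : Integrable f P :=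
  memLp_one_iff_integrable.1 (by simpa using hf 1)

lemma HasAllMoments.integrable_norm_pow {f : Ω → ℂ} [IsFiniteMeasure P] (hf : HasAllMoments f P)
    (k : ℕ) : Integrable (fun ω => ‖f ω‖ ^ k) P :=
  (hf k).integrable_norm_pow'

lemma HasAllMoments.of_hasLaw_complexGaussian [IsFiniteMeasure P] {v : ℝ≥0} (hv : v ≠ 0)
    {f : Ω → ℂ} (hf : HasLaw f (complexGaussian v) P) : HasAllMoments f P := by
  intro p
  rcases eq_or_ne p 0 with rfl | hp
  · simpa using hf.aemeasurable.aestronglyMeasurable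
  rw [← integrable_norm_rpow_iff hf.aemeasurable.aestronglyMeasurable (by simpa using hp) (by simp)]
  have h := integrable_norm_pow_complexGaussian hv p
  rw [← hf.map_eq] at h
  simpa [Function.comp_def] using h.comp_aemeasurable hf.aemeasurable

end Moments

/-! ### Traces of products as sums over closed paths -/

section Trace

variable {ι R : Type*} [Fintype ι] [DecidableEq ι] [CommRing R]

/-- The function `p` lists the vertices of a path after its start `x`; the condition in the sum
fixes its endpoint. -/
lemma list_ofFn_prod_apply : ∀ {n : ℕ} (M : Fin n → Matrix ι ι R) (x y : ι),
    (List.ofFn M).prod x y = ∑ p : Fin n → ι,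
      if (Fin.cons x p : Fin (n + 1) → ι) (Fin.last n) = y then
        ∏ l, M l ((Fin.cons x p : Fin (n + 1) → ι) l.castSucc) (p l) else 0
  | 0, M, x, y => by
    simp [Matrix.one_apply]
  | n + 1, M, x, y => by
    rw [List.ofFn_succ, List.prod_cons, Matrix.mul_apply,
      ← (Fin.consEquiv fun _ : Fin (n + 1) => ι).sum_comp, Fintype.sum_prod_type]
    refine Finset.sum_congr rfl fun z _ => ?_
    rw [list_ofFn_prod_apply, Finset.mul_sum]
    refine Finset.sum_congr rfl fun p _ => ?_
    simp only [Fin.consEquiv_apply, mul_ite, mul_zero]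
    rw [← Fin.succ_last, Fin.cons_succ, Fin.prod_univ_succ]
    simp only [Fin.castSucc_zero, Fin.cons_zero, Fin.cons_succ, ← Fin.succ_castSucc]
    rfl

lemma trace_list_ofFn_prod {n : ℕ} (hn : n ≠ 0) (M : Fin n → Matrix ι ι R) :
    (List.ofFn M).prod.trace = ∑ i : Fin n → ι, ∏ l, M l (i l) (i (finRotate n l)) := by
  obtain ⟨m, rfl⟩ := Nat.exists_eq_succ_of_ne_zero hn
  simp only [Matrix.trace, Matrix.diag_apply, list_ofFn_prod_apply]
  -- Since `p l` is the vertex after step `l`, a rotation turns it into the vertex before that step.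
  -- The closing condition then eliminates the sum over the start.
  rw [Finset.sum_comm, ← (Equiv.arrowCongr (finRotate (m + 1)).symm (Equiv.refl ι)).sum_comp]
  refine Finset.sum_congr rfl fun i _ => ?_
  simp only [← Fin.succ_last, Fin.cons_succ]
  rw [Finset.sum_ite_eq, if_pos (Finset.mem_univ _)]
  refine Finset.prod_congr rfl fun l _ => ?_
  congr 1
  · refine Fin.cases ?_ (fun k => ?_) l
    · simp
    · rw [← Fin.succ_castSucc, Fin.cons_succ]
      simp

/-- Powers of a sum over closed paths. -/
lemma sum_prod_pow {E ι R : Type*} [Fintype E] [DecidableEq E] [Fintype ι] [CommRing R] (s : E → E)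
    (F : E → ι → ι → R) (a : ℕ) :
    (∑ i : E → ι, ∏ e, F e (i e) (i (s e))) ^ a =
      ∑ i : Fin a × E → ι, ∏ e : Fin a × E, F e.2 (i e) (i (e.1, s e.2)) := by
  rw [Fintype.sum_pow, ← (Equiv.curry (Fin a) E ι).sum_comp]
  refine Finset.sum_congr rfl fun i _ => ?_
  rw [Fintype.prod_prod_type]
  rfl

lemma trace_wordMatrix {N : ℕ} {w : StarWord} (hne : w ≠ []) (hw : IsStarFree w)
    (G : ℕ → Matrix (Fin N) (Fin N) ℂ) :
    (wordMatrix G w).trace = ∑ i : Fin w.length → Fin N,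
      ∏ l, G (w.get l).index (i l) (i (finRotate _ l)) := by
  have h : w.map (letterMatrix G) = List.ofFn fun l => G (w.get l).index := by
    conv_lhs => rw [← List.ofFn_get w, List.map_ofFn]
    congr 1
    ext1 l
    simp only [Function.comp_apply, letterMatrix, hw _ (List.get_mem w l)]
    rfl
  rw [wordMatrix, h, trace_list_ofFn_prod (by simpa using hne)]

end Trace

/-! ### Counting closed paths -/

section Count

/-- If `f e ≠ g e`, the value of `j` at `f e` is determined by its value at `g e`, which removes one
degree of freedom. -/
lemma card_comp_eq_comp_le {A B : Type*} [Fintype B] (N : ℕ) {f g : A → B} (h : f ≠ g) :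
    Nat.card {j : B → Fin N // j ∘ f = j ∘ g} ≤ N ^ (Fintype.card B - 1) := by
  classical
  obtain ⟨e, he⟩ := Function.ne_iff.1 h
  have hinj : Function.Injective fun (j : {j : B → Fin N // j ∘ f = j ∘ g})
      (b : {b // b ≠ f e}) => j.1 b := by
    intro j j' hj
    have hval : ∀ b, b ≠ f e → j.1 b = j'.1 b := fun b hb => congrFun hj ⟨b, hb⟩
    ext1
    ext1 b
    by_cases hb : b = f e
    · have h1 : j.1 (f e) = j.1 (g e) := congrFun j.2 e
      have h2 : j'.1 (f e) = j'.1 (g e) := congrFun j'.2 e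
      rw [hb, h1, h2, hval _ he.symm]
    · exact hval b hb
  refine (Nat.card_le_card_of_injective _ hinj).trans ?_
  simp [Nat.card_eq_fintype_card, Fintype.card_subtype_compl]

lemma tendsto_card_comp_eq_comp {A B : Type*} [Fintype B] (f g : A → B) [Decidable (f = g)] :
    Tendsto (fun N : ℕ => ((N : ℂ)⁻¹) ^ Fintype.card B *
      Nat.card {j : B → Fin N // j ∘ f = j ∘ g}) atTop (𝓝 (if f = g then 1 else 0)) := by
  split_ifs with h
  · refine tendsto_const_nhds.congr' ?_
    filter_upwards [eventually_ne_atTop 0] with N hN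
    have : Nat.card {j : B → Fin N // j ∘ f = j ∘ g} = N ^ Fintype.card B := by
      classical
      simp [h, Nat.card_eq_fintype_card]
    rw [this, Nat.cast_pow, ← mul_pow, inv_mul_cancel₀ (by exact_mod_cast hN), one_pow]
  · obtain ⟨e, -⟩ := Function.ne_iff.1 h
    have hB : 1 ≤ Fintype.card B := Fintype.card_pos_iff.2 ⟨f e⟩
    refine squeeze_zero_norm' ?_ (tendsto_inv_atTop_nhds_zero_nat (𝕜 := ℝ))
    filter_upwards [eventually_ne_atTop 0] with N hN
    have hN' : (0 : ℝ) < N := by positivity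
    rw [norm_mul, norm_pow, norm_inv, Complex.norm_natCast, Complex.norm_natCast]
    calc ((N : ℝ)⁻¹) ^ Fintype.card B * (Nat.card {j : B → Fin N // j ∘ f = j ∘ g} : ℝ)
        ≤ ((N : ℝ)⁻¹) ^ Fintype.card B * (N : ℝ) ^ (Fintype.card B - 1) := by
          gcongr
          exact_mod_cast card_comp_eq_comp_le N h
      _ = (N : ℝ)⁻¹ := by
          obtain ⟨b, hb⟩ := Nat.exists_eq_add_of_le hB
          rw [hb, Nat.add_sub_cancel_left, pow_add, pow_one, mul_assoc, ← mul_pow,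
            inv_mul_cancel₀ hN'.ne', one_pow, mul_one]

end Count

/-! ### Mixed moments of traces -/

section TraceMoments

variable {E : Type*} [Fintype E] [DecidableEq E]

/-- The bijections between several copies of a labelled set with a self-map `s`, that preserve the
labels and commute with `s`. -/
abbrev LabelledEquiv (s : E → E) (r : E → ℕ) (a b : ℕ) : Type _ :=
  {σ : Fin a × E ≃ Fin b × E // (∀ e, r (σ e).2 = r e.2) ∧
    (fun e => ((σ e).1, s (σ e).2)) = fun e : Fin a × E => σ (e.1, s e.2)}

variable {Ω : Type*} [MeasurableSpace Ω] {P : Measure Ω} [IsProbabilityMeasure P]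

lemma integral_path_sum_pow_mul_conj_pow {N : ℕ} {v : ℝ≥0} (hv : v ≠ 0)
    {X : ℕ × Fin N × Fin N → Ω → ℂ} (hX : iIndepFun X P)
    (hlaw : ∀ q, HasLaw (X q) (complexGaussian v) P) (s : E → E) (r : E → ℕ) (a b : ℕ) :
    ∫ ω, (∑ i : E → Fin N, ∏ e, X (r e, i e, i (s e)) ω) ^ a *
      (starRingEnd ℂ (∑ i : E → Fin N, ∏ e, X (r e, i e, i (s e)) ω)) ^ b ∂P =
      ∑ σ : Fin a × E ≃ Fin b × E, if ∀ e, r (σ e).2 = r e.2 then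
        (v : ℂ) ^ Fintype.card (Fin b × E) *
          Nat.card {j : Fin b × E → Fin N // (j ∘ fun e => ((σ e).1, s (σ e).2)) =
            j ∘ fun e : Fin a × E => σ (e.1, s e.2)} else 0 := by
  classical
  let c (i : Fin a × E → Fin N) (e : Fin a × E) : ℕ × Fin N × Fin N :=
    (r e.2, i e, i (e.1, s e.2))
  let d (j : Fin b × E → Fin N) (e : Fin b × E) : ℕ × Fin N × Fin N :=
    (r e.2, j e, j (e.1, s e.2))
  have h1 : ∀ ω, (∑ i : E → Fin N, ∏ e, X (r e, i e, i (s e)) ω) ^ a *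
      (starRingEnd ℂ (∑ i : E → Fin N, ∏ e, X (r e, i e, i (s e)) ω)) ^ b =
      ∑ i, ∑ j, (∏ e, X (c i e) ω) * ∏ f, starRingEnd ℂ (X (d j f) ω) := by
    intro ω
    rw [← map_pow, sum_prod_pow s (fun e x y => X (r e, x, y) ω) a,
      sum_prod_pow s (fun e x y => X (r e, x, y) ω) b, map_sum, Finset.sum_mul_sum]
    simp only [map_prod, c, d]
  have hmom : ∀ q, HasAllMoments (X q) P := fun q => .of_hasLaw_complexGaussian hv (hlaw q)
  have hint : ∀ i j, Integrable
      (fun ω => (∏ e, X (c i e) ω) * ∏ f, starRingEnd ℂ (X (d j f) ω)) P := fun i j =>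
    ((HasAllMoments.prod _ fun e _ => hmom _).mul
      (HasAllMoments.prod _ fun f _ => (hmom _).conj)).integrable
  simp_rw [h1]
  rw [integral_finsetSum _ fun i _ => integrable_finsetSum _ fun j _ => hint i j]
  simp_rw [integral_finsetSum _ fun j _ => hint _ j, wick hv hX hlaw,
    Nat.card_eq_fintype_card, Fintype.card_subtype, Finset.card_filter, Nat.cast_sum,
    Finset.mul_sum]
  rw [Finset.sum_comm, Finset.sum_congr rfl fun j _ => Finset.sum_comm, Finset.sum_comm]
  refine Finset.sum_congr rfl fun σ _ => ?_
  have hcard : Fintype.card (Fin a × E) = Fintype.card (Fin b × E) := Fintype.card_congr σ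
  simp_rw [hcard]
  -- Matching row indices determine `i` from `j`. Matching column indices then leave a condition on
  -- `j` alone, so the sum over `i` collapses.
  have key : ∀ i j, d j ∘ σ = c i ↔ i = j ∘ σ ∧ ((∀ e, r (σ e).2 = r e.2) ∧
      (j ∘ fun e => ((σ e).1, s (σ e).2)) = j ∘ fun e : Fin a × E => σ (e.1, s e.2)) := by
    intro i j
    simp only [funext_iff, c, d, Function.comp_apply, Prod.ext_iff]
    constructor
    · intro h
      have hi : ∀ e, i e = j (σ e) := fun e => (h e).2.1.symm
      exact ⟨hi, fun e => (h e).1, fun e => (h e).2.2.trans (hi _)⟩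
    · rintro ⟨hi, hr, hs⟩ e
      exact ⟨hr e, (hi e).symm, (hs e).trans (hi _).symm⟩
  simp_rw [key, ite_and]
  simp only [Nat.cast_ite, Nat.cast_one, Nat.cast_zero, mul_ite, mul_one, mul_zero,
    Finset.sum_ite_eq', Finset.mem_univ, if_true]
  split_ifs with h
  · simp
  · simp

/-- The mixed moments of a path sum converge to a number of label-preserving bijections. -/
theorem tendsto_integral_path_sum {Ω : ℕ → Type*} [∀ N, MeasurableSpace (Ω N)]
    (P : (N : ℕ) → Measure (Ω N)) [∀ N, IsProbabilityMeasure (P N)]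
    {X : (N : ℕ) → ℕ × Fin N × Fin N → Ω N → ℂ} (hX : ∀ N, iIndepFun (X N) (P N))
    (hlaw : ∀ N q, HasLaw (X N q) (complexGaussian (N : ℝ≥0)⁻¹) (P N)) (s : E → E) (r : E → ℕ)
    (a b : ℕ) :
    Tendsto (fun N => ∫ ω, (∑ i : E → Fin N, ∏ e, X N (r e, i e, i (s e)) ω) ^ a *
      (starRingEnd ℂ (∑ i : E → Fin N, ∏ e, X N (r e, i e, i (s e)) ω)) ^ b ∂(P N)) atTop
      (𝓝 (Nat.card (LabelledEquiv s r a b))) := by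
  classical
  have hlim : (Nat.card (LabelledEquiv s r a b) : ℂ) = ∑ σ : Fin a × E ≃ Fin b × E,
      if ∀ e, r (σ e).2 = r e.2 then (if (fun e => ((σ e).1, s (σ e).2)) =
        (fun e : Fin a × E => σ (e.1, s e.2)) then 1 else 0) else 0 := by
    rw [Nat.card_eq_fintype_card, Fintype.card_subtype, Finset.card_filter, Nat.cast_sum]
    refine Finset.sum_congr rfl fun σ _ => ?_
    rw [ite_and]
    split_ifs <;> simp
  rw [hlim]
  refine Tendsto.congr' (f₁ := fun N : ℕ => ∑ σ : Fin a × E ≃ Fin b × E,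
      if ∀ e, r (σ e).2 = r e.2 then
        (N : ℂ)⁻¹ ^ Fintype.card (Fin b × E) *
          (Nat.card {j : Fin b × E → Fin N // (j ∘ fun e => ((σ e).1, s (σ e).2)) =
            j ∘ fun e : Fin a × E => σ (e.1, s e.2)} : ℂ) else 0) ?_ ?_
  · filter_upwards [eventually_ne_atTop 0] with N hN
    rw [integral_path_sum_pow_mul_conj_pow (v := (N : ℝ≥0)⁻¹) (by simpa using hN) (hX N) (hlaw N)]
    simp
  · refine tendsto_finsetSum _ fun σ _ => ?_
    split_ifs with h h'
    · simpa [h'] using tendsto_card_comp_eq_comp (fun e => ((σ e).1, s (σ e).2))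
        (fun e : Fin a × E => σ (e.1, s e.2))
    · simpa [h'] using tendsto_card_comp_eq_comp (fun e => ((σ e).1, s (σ e).2))
        (fun e : Fin a × E => σ (e.1, s e.2))
    · exact tendsto_const_nhds

end TraceMoments

/-! ### Rotations preserving a word -/

/-- The rotations of a cyclic sequence that preserve the labels. -/
abbrev Period {α : Type*} {n : ℕ} [NeZero n] (r : Fin n → α) : Type :=
  {k : Fin n // ∀ l, r (l + k) = r l}

section LabelledEquiv

open Function

variable {n : ℕ} [NeZero n]

/-- The bijection built from a permutation of the copies and a period for each copy. -/
def labelledEquivOfPeriods (r : Fin n → ℕ) (a : ℕ)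
    (p : Equiv.Perm (Fin a) × (Fin a → Period r)) :
    LabelledEquiv (finRotate n) r a a :=
  ⟨Equiv.prodShear p.1 fun x => Equiv.addRight (p.2 x).1,
    fun e => (p.2 e.1).2 e.2, by
      ext1 e
      simp [Equiv.prodShear, add_right_comm]⟩

open Fin.CommRing in
-- Commutation with the rotation determines σ on a whole copy from its value at the base point `0`.
lemma LabelledEquiv.apply_eq {r : Fin n → ℕ} {a b : ℕ}
    (σ : LabelledEquiv (finRotate n) r a b) (x : Fin a) (l : Fin n) :
    σ.1 (x, l) = ((σ.1 (x, 0)).1, l + (σ.1 (x, 0)).2) := by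
  have h : ∀ m : ℕ, σ.1 (x, (m : Fin n)) = ((σ.1 (x, 0)).1, (m : Fin n) + (σ.1 (x, 0)).2) := by
    intro m
    induction m with
    | zero => simp
    | succ m ih =>
      have h1 := congrFun σ.2.2 (x, (m : Fin n))
      simp only [finRotate_apply, ih] at h1
      rw [Nat.cast_succ, ← h1, add_right_comm]
  simpa using h l.val

lemma labelledEquivOfPeriods_bijective (r : Fin n → ℕ) (a : ℕ) :
    Bijective (labelledEquivOfPeriods r a) := by
  constructor
  · intro p q hpq
    have h : ∀ x l, (p.1 x, l + (p.2 x).1) = (q.1 x, l + (q.2 x).1) := fun x l =>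
      congrArg (fun σ : LabelledEquiv (finRotate n) r a a => σ.1 (x, l)) hpq
    refine Prod.ext (Equiv.ext fun x => (Prod.ext_iff.1 (h x 0)).1) (funext fun x => ?_)
    have := (Prod.ext_iff.1 (h x 0)).2
    exact Subtype.ext (by simpa using this)
  · intro σ
    -- Each copy is sent into a single copy, so surjectivity of σ makes the induced map of copies
    -- surjective, hence a permutation.
    have hsurj : Surjective fun x => (σ.1 (x, 0)).1 := by
      intro y
      obtain ⟨⟨x, l⟩, hx⟩ := σ.1.surjective (y, 0)
      exact ⟨x, by rw [σ.apply_eq] at hx; exact congrArg Prod.fst hx⟩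
    refine ⟨⟨Equiv.ofBijective _ (Finite.surjective_iff_bijective.1 hsurj), fun x =>
      ⟨(σ.1 (x, 0)).2, fun l => ?_⟩⟩, ?_⟩
    · simpa [σ.apply_eq x l] using σ.2.1 (x, l)
    · refine Subtype.ext (Equiv.ext fun e => ?_)
      rw [show e = (e.1, e.2) from rfl, σ.apply_eq]
      rfl

lemma card_labelledEquiv (r : Fin n → ℕ) (a b : ℕ) :
    Nat.card (LabelledEquiv (finRotate n) r a b) =
      if a = b then a.factorial * Nat.card (Period r) ^ a else 0 := by
  split_ifs with hab
  · subst hab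
    rw [← Nat.card_congr (Equiv.ofBijective _ (labelledEquivOfPeriods_bijective r a)),
      Nat.card_prod, Nat.card_perm, Nat.card_fun]
    simp
  · have : IsEmpty (LabelledEquiv (finRotate n) r a b) := by
      refine ⟨fun σ => hab ?_⟩
      have := Fintype.card_congr σ.1
      simpa [NeZero.ne n] using this
    exact Nat.card_of_isEmpty

end LabelledEquiv

/-! ### The coperiod -/

lemma length_wordPow (u : StarWord) (k : ℕ) : (wordPow u k).length = k * u.length := by
  simp [wordPow]

lemma wordPow_getElem? (u : StarWord) (k z : ℕ) (hz : z < k * u.length) :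
    (wordPow u k)[z]? = u[z % u.length]? := by
  induction k generalizing z with
  | zero => simp at hz
  | succ k ih =>
    have h : wordPow u (k + 1) = u ++ wordPow u k := by
      simp [wordPow, List.replicate_succ]
    rw [h, List.getElem?_append]
    split_ifs with hz'
    · rw [Nat.mod_eq_of_lt hz']
    · push Not at hz'
      rw [ih _ (by rw [add_mul] at hz; omega), ← Nat.mod_eq_sub_mod hz']

/-- `k` is a period of the infinite repetition of the word `w`. -/
def IsPeriod (w : StarWord) (k : ℕ) : Prop :=
  ∀ z : ℕ, w[(z + k) % w.length]? = w[z % w.length]?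

lemma isPeriod_length (w : StarWord) : IsPeriod w w.length := fun z => by simp

lemma IsPeriod.mul {w : StarWord} {d : ℕ} (hd : IsPeriod w d) (m : ℕ) : IsPeriod w (d * m) := by
  induction m with
  | zero => intro z; rfl
  | succ m ih => intro z; rw [Nat.mul_succ, ← add_assoc, hd, ih]

/-- The least positive period. -/
lemma exists_isPeriod_iff_dvd {w : StarWord} (hne : w ≠ []) :
    ∃ d : ℕ, 0 < d ∧ ∀ k, IsPeriod w k ↔ d ∣ k := by
  classical
  have hex : ∃ d, 0 < d ∧ IsPeriod w d :=
    ⟨w.length, List.length_pos_iff.2 hne, isPeriod_length w⟩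
  obtain ⟨hpos, hper⟩ := Nat.find_spec hex
  refine ⟨Nat.find hex, hpos, fun k => ⟨fun hk => ?_, ?_⟩⟩
  · have hmod : IsPeriod w (k % Nat.find hex) := by
      intro z
      rw [← hper.mul (k / Nat.find hex), add_assoc, Nat.mod_add_div, hk]
    by_contra hnd
    have h0 : 0 < k % Nat.find hex := Nat.pos_of_ne_zero fun h => hnd (Nat.dvd_of_mod_eq_zero h)
    exact Nat.find_min hex (Nat.mod_lt _ hpos) ⟨h0, hmod⟩
  · rintro ⟨m, rfl⟩
    exact hper.mul m

lemma isPeriod_length_of_eq_wordPow {w u : StarWord} {k : ℕ} (hne : w ≠ []) (h : w = wordPow u k) :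
    IsPeriod w u.length := by
  intro z
  have hlen : w.length = k * u.length := by rw [h, length_wordPow]
  have hpos : 0 < w.length := List.length_pos_iff.2 hne
  have key : ∀ z, w[z % w.length]? = u[z % u.length]? := by
    intro z
    have hlt := Nat.mod_lt z hpos
    conv_lhs => rw [h]
    rw [wordPow_getElem? _ _ _ (by rw [length_wordPow, ← hlen]; exact hlt), length_wordPow, mul_comm,
      Nat.mod_mul_right_mod]
  rw [key, key, Nat.add_mod_right]

/-- The prefix of length `d` is a root of `w`. The length of any root is a period, hence at least
`d`, so no larger exponent occurs. -/
lemma coperiod_eq_div {w : StarWord} (hne : w ≠ []) {d : ℕ} (hd : 0 < d)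
    (hdvd : ∀ k, IsPeriod w k ↔ d ∣ k) : coperiod w = w.length / d := by
  have hpos : 0 < w.length := List.length_pos_iff.2 hne
  obtain ⟨m, hm⟩ := (hdvd _).1 (isPeriod_length w)
  have hdiv : w.length / d = m := by rw [hm, Nat.mul_div_cancel_left _ hd]
  rw [hdiv]
  refine IsGreatest.csSup_eq ⟨⟨w.take d, ?_⟩, ?_⟩
  · have hm0 : 0 < m := Nat.pos_of_ne_zero fun h => by rw [h, mul_zero] at hm; omega
    have hle : d ≤ w.length := by rw [hm]; exact Nat.le_mul_of_pos_right d hm0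
    have hlt : (w.take d).length = d := by simp [hle]
    refine List.ext_getElem? fun z => ?_
    by_cases hz : z < w.length
    · rw [wordPow_getElem? _ _ _ (by rw [hlt, mul_comm, ← hm]; exact hz), hlt,
        List.getElem?_take_of_lt (Nat.mod_lt z hd)]
      have h := ((hdvd d).2 dvd_rfl).mul (z / d) (z % d)
      rwa [Nat.mod_add_div, Nat.mod_eq_of_lt hz,
        Nat.mod_eq_of_lt ((Nat.mod_lt z hd).trans_le hle)] at h
    · push Not at hz
      rw [List.getElem?_eq_none hz, List.getElem?_eq_none]
      rwa [length_wordPow, hlt, mul_comm, ← hm]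
  · rintro k ⟨u, hu⟩
    have hlen : w.length = k * u.length := by rw [hu, length_wordPow]
    have hu0 : 0 < u.length := Nat.pos_of_ne_zero fun h => by rw [h, mul_zero] at hlen; omega
    have hle : d ≤ u.length :=
      Nat.le_of_dvd hu0 ((hdvd _).1 (isPeriod_length_of_eq_wordPow hne hu))
    by_contra hlt
    push Not at hlt
    have : d * m < k * u.length := by nlinarith
    omega

open Fin.NatCast in
lemma isPeriod_iff_get {w : StarWord} [NeZero w.length] (k : Fin w.length) :
    IsPeriod w k ↔ ∀ l, w.get (l + k) = w.get l := by
  constructor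
  · intro h l
    have := h l
    rw [← Fin.val_add, List.getElem?_eq_getElem (l + k).2, Nat.mod_eq_of_lt l.2,
      List.getElem?_eq_getElem l.2] at this
    simpa using this
  · intro h z
    have := h (z : Fin w.length)
    have h1 : (z + k : ℕ) % w.length = ((z : Fin w.length) + k : Fin w.length) := by
      rw [Fin.val_add, Fin.val_natCast, Nat.mod_add_mod]
    have h2 : z % w.length = ((z : Fin w.length) : ℕ) := by rw [Fin.val_natCast]
    rw [h1, h2, List.getElem?_eq_getElem (Fin.is_lt _), List.getElem?_eq_getElem (Fin.is_lt _)]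
    exact congrArg some this

lemma card_period_get {w : StarWord} (hne : w ≠ []) [NeZero w.length] :
    Nat.card (Period w.get) = coperiod w := by
  obtain ⟨d, hd, hdvd⟩ := exists_isPeriod_iff_dvd hne
  rw [coperiod_eq_div hne hd hdvd]
  obtain ⟨m, hm⟩ := (hdvd _).1 (isPeriod_length w)
  have hdiv : w.length / d = m := by rw [hm, Nat.mul_div_cancel_left _ hd]
  rw [hdiv]
  -- With `|w| = d * m`, the periods below `|w|` are the multiples `d * j` with `j < m`.
  have hbij : Function.Bijective fun j : Fin m =>
      (⟨⟨d * j, by rw [hm]; exact Nat.mul_lt_mul_of_pos_left j.2 hd⟩,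
        (isPeriod_iff_get _).1 ((hdvd _).2 (Dvd.intro _ rfl))⟩ : Period w.get) := by
    constructor
    · intro i j hij
      simp only [Subtype.mk.injEq, Fin.mk.injEq] at hij
      exact Fin.ext (Nat.eq_of_mul_eq_mul_left hd hij)
    · rintro ⟨k, hk⟩
      obtain ⟨j, hj⟩ := (hdvd _).1 ((isPeriod_iff_get k).2 hk)
      refine ⟨⟨j, ?_⟩, Subtype.ext (Fin.ext hj.symm)⟩
      have := k.2
      rw [hj, hm] at this
      exact Nat.lt_of_mul_lt_mul_left this
  rw [← Nat.card_congr (Equiv.ofBijective _ hbij), Nat.card_fin]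

lemma coperiod_pos {w : StarWord} (hne : w ≠ []) : 0 < coperiod w := by
  have : NeZero w.length := ⟨by simpa using hne⟩
  have : Nonempty (Period w.get) := ⟨⟨0, by simp⟩⟩
  rw [← card_period_get hne]
  exact Nat.card_pos

lemma IsStarFree.get_eq_iff {w : StarWord} (hw : IsStarFree w) (i j : Fin w.length) :
    w.get i = w.get j ↔ (w.get i).index = (w.get j).index := by
  refine ⟨congrArg _, fun h => ?_⟩
  have h1 := hw _ (List.get_mem w i)
  have h2 := hw _ (List.get_mem w j)
  revert h h1 h2
  cases w.get i
  cases w.get j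
  simp_all

lemma card_period_index {w : StarWord} (hne : w ≠ []) (hw : IsStarFree w) [NeZero w.length] :
    Nat.card (Period fun l => (w.get l).index) = coperiod w := by
  rw [← card_period_get hne]
  exact Nat.card_congr (Equiv.subtypeEquivRight fun k => forall_congr' fun l =>
    (hw.get_eq_iff _ _).symm)

/-! ### Convergence in law of the trace -/

theorem tendstoInDistribution_trace (w : StarWord) (hne : w ≠ []) (hw : IsStarFree w)
    {Ω : ℕ → Type*} [∀ N, MeasurableSpace (Ω N)]
    (P : (N : ℕ) → Measure (Ω N)) [∀ N, IsProbabilityMeasure (P N)]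
    (G : (N : ℕ) → ℕ → Ω N → Matrix (Fin N) (Fin N) ℂ) (hG : ∀ N, IsGinibreSequence (G N) (P N)) :
    TendstoInDistribution (fun N (ω : Ω N) => (wordMatrix (fun r => G N r ω) w).trace)
      atTop (id : ℂ → ℂ) P (complexGaussian (coperiod w : ℝ≥0)) := by
  have : NeZero w.length := ⟨by simpa using hne⟩
  have hv : (coperiod w : ℝ≥0) ≠ 0 := by exact_mod_cast (coperiod_pos hne).ne'
  simp_rw [trace_wordMatrix hne hw]
  set T : (N : ℕ) → Ω N → ℂ := fun N ω => ∑ i : Fin w.length → Fin N,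
      ∏ l, G N (w.get l).index ω (i l) (i (finRotate _ l)) with hT
  have hmom : ∀ N, HasAllMoments (T N) (P N) := by
    intro N
    refine HasAllMoments.sum _ fun i _ => HasAllMoments.prod _ fun l _ => ?_
    -- A path `i` exists only for `N > 0`, which disposes of the degenerate case `N = 0`.
    have hN : ((N : ℝ≥0)⁻¹) ≠ 0 := by
      exact inv_ne_zero (by exact_mod_cast (Fin.pos (i 0)).ne')
    exact .of_hasLaw_complexGaussian hN ((hG N).law _ _ _)
  have hmeas : ∀ N, AEMeasurable (T N) (P N) := fun N => (hmom N).integrable.aemeasurable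
  refine ⟨hmeas, by fun_prop, ?_⟩
  refine tendsto_of_tendsto_moments (fun N k => ?_) (fun k => ?_) (fun a b => ?_) (fun r => ?_)
  · simp only [ProbabilityMeasure.coe_mk]
    rw [integrable_map_measure (by fun_prop) (hmeas N)]
    exact (hmom N).integrable_norm_pow k
  · simpa using integrable_norm_pow_complexGaussian hv k
  · have h1 : ∀ N, ∫ z, z ^ a * (starRingEnd ℂ z) ^ b ∂(P N).map (T N) =
        ∫ ω, T N ω ^ a * (starRingEnd ℂ (T N ω)) ^ b ∂P N :=
      fun N => integral_map (hmeas N) (by fun_prop)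
    have h2 := tendsto_integral_path_sum P
      (X := fun N (q : ℕ × Fin N × Fin N) ω => G N q.1 ω q.2.1 q.2.2) (fun N => (hG N).indep)
      (fun N q => (hG N).law q.1 q.2.1 q.2.2) (finRotate w.length) (fun l => (w.get l).index) a b
    simp only [ProbabilityMeasure.coe_mk, Measure.map_id, h1,
      integral_pow_mul_conj_pow_complexGaussian hv]
    rw [card_labelledEquiv, card_period_index hne hw] at h2
    convert h2 using 2
    split_ifs <;> simp
  · simpa using tendsto_moment_growth_complexGaussian hv r

/-! ### Spherical pairings -/

section Orbits

variable {X : Type*} [Finite X] {g : X → X}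

/-- A self-map without fixed points has exactly `|X| / 2` orbits if and only if it is an
involution. -/
lemma two_mul_card_quot_eq_iff (hg : ∀ e, g e ≠ e) :
    2 * Nat.card (Quot fun e f : X => f = g e) = Nat.card X ↔ ∀ e, g (g e) = e := by
  classical
  have := Fintype.ofFinite X
  let Q := Quot fun e f : X => f = g e
  let π : X → Q := Quot.mk _
  have := Fintype.ofFinite Q
  have hπ : ∀ e, π (g e) = π e := fun e => (Quot.sound (r := fun e f : X => f = g e) rfl).symm
  have hsub : ∀ e, ({e, g e} : Finset X) ⊆ Finset.univ.filter fun f => π f = π e := by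
    intro e f hf
    rcases Finset.mem_insert.1 hf with rfl | hf
    · simp
    · rw [Finset.mem_singleton.1 hf]
      simp [hπ]
  have hpair : ∀ e, ({e, g e} : Finset X).card = 2 := fun e => Finset.card_pair (hg e).symm
  have hge : ∀ q ∈ (Finset.univ : Finset Q), 2 ≤ (Finset.univ.filter fun f => π f = q).card := by
    intro q _
    obtain ⟨e, rfl⟩ := Quot.exists_rep q
    exact (hpair e).symm.le.trans (Finset.card_le_card (hsub e))
  have hsum : Nat.card X = ∑ q : Q, (Finset.univ.filter fun f => π f = q).card := by
    rw [Nat.card_eq_fintype_card, ← Finset.card_univ]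
    exact Finset.card_eq_sum_card_fiberwise fun _ _ => Finset.mem_coe.2 (Finset.mem_univ _)
  have htwo : 2 * Nat.card Q = ∑ _q : Q, 2 := by
    simp [Nat.card_eq_fintype_card, mul_comm]
  change 2 * Nat.card Q = _ ↔ _
  -- Every orbit contains some pair `{e, g e}`, so equality of the totals means that every orbit has
  -- exactly two elements.
  rw [htwo, hsum, Finset.sum_eq_sum_iff_of_le hge]
  constructor
  · intro h e
    have heq := Finset.eq_of_subset_of_card_le (hsub e)
      (by rw [hpair]; exact (h (π e) (Finset.mem_univ _)).ge)
    have hmem : g (g e) ∈ ({e, g e} : Finset X) := by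
      rw [heq]
      simp [hπ]
    rcases Finset.mem_insert.1 hmem with h1 | h1
    · exact h1
    · exact absurd (Finset.mem_singleton.1 h1) (hg _)
  · intro h q _
    obtain ⟨e, rfl⟩ := Quot.exists_rep q
    rw [← hpair e]
    congr 1
    refine (hsub e).antisymm fun f hf => ?_
    -- For an involution the pair `{e, g e}` is constant along orbits, so it descends to the
    -- quotient and recovers the whole orbit.
    let κ : Q → Finset X := Quot.lift (fun e => {e, g e}) (by
      rintro a b rfl
      rw [h, Finset.pair_comm])
    have hκ : κ (π f) = κ (π e) := congrArg κ (Finset.mem_filter.1 hf).2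
    change ({f, g f} : Finset X) = {e, g e} at hκ
    rw [← hκ]
    simp

end Orbits

lemma numSpherical_eq_zero_of_isStarFree {k : ℕ} (ws : Fin k → StarWord) (e : Edge ws)
    (h : ∀ j, IsStarFree (ws j)) : numSpherical ws = 0 := by
  have hstar : ∀ e, (label ws e).starred = false := fun e => h e.1 _ (List.get_mem _ _)
  have : IsEmpty {φ : Equiv.Perm (Edge ws) // IsAdmissible ws φ ∧ IsSpherical ws φ} :=
    ⟨fun φ => (φ.2.1.2 e).2 (by rw [hstar, hstar])⟩
  exact Nat.card_of_isEmpty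

section TwoFaces

variable (w : StarWord)

lemma length_adjointWord : (adjointWord w).length = w.length := by
  simp [adjointWord]

/-- An edge of the face of `w`. -/
def innerEdge (l : Fin w.length) : Edge ![w, adjointWord w] := ⟨0, l⟩

/-- The edge of the face of `w^*` that corresponds to an edge of the face of `w`. -/
def outerEdge (l : Fin w.length) : Edge ![w, adjointWord w] :=
  ⟨1, Fin.cast (length_adjointWord w).symm l.rev⟩

lemma innerEdge_injective : Function.Injective (innerEdge w) := by
  intro l l' h
  exact eq_of_heq (Sigma.mk.inj h).2

lemma outerEdge_injective : Function.Injective (outerEdge w) := by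
  intro l l' h
  simp only [outerEdge, Sigma.mk.injEq, heq_eq_eq, true_and] at h
  exact Fin.rev_injective (Fin.cast_injective _ h)

lemma innerEdge_or_outerEdge (e : Edge ![w, adjointWord w]) :
    (∃ l, e = innerEdge w l) ∨ ∃ l, e = outerEdge w l := by
  obtain ⟨j, l⟩ := e
  fin_cases j
  · exact Or.inl ⟨l, rfl⟩
  · refine Or.inr ⟨(Fin.cast (length_adjointWord w) l).rev, ?_⟩
    simp only [outerEdge, Fin.rev_rev]
    rfl

/-- The edges of the two faces. -/
noncomputable def edgeEquiv : Fin w.length ⊕ Fin w.length ≃ Edge ![w, adjointWord w] :=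
  Equiv.ofBijective (Sum.elim (innerEdge w) (outerEdge w)) <| by
    refine ⟨(innerEdge_injective w).sumElim (outerEdge_injective w) fun l l' h => ?_, fun e => ?_⟩
    · exact absurd (congrArg Sigma.fst h) (by simp [innerEdge, outerEdge])
    · rcases innerEdge_or_outerEdge w e with ⟨l, rfl⟩ | ⟨l, rfl⟩
      · exact ⟨Sum.inl l, rfl⟩
      · exact ⟨Sum.inr l, rfl⟩

lemma card_edge : Nat.card (Edge ![w, adjointWord w]) = 2 * w.length := by
  rw [← Nat.card_congr (edgeEquiv w), Nat.card_sum, Nat.card_fin, two_mul]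

lemma label_innerEdge (l : Fin w.length) :
    label ![w, adjointWord w] (innerEdge w l) = w.get l := rfl

lemma adjointWord_get (l : Fin w.length) :
    (adjointWord w).get (Fin.cast (length_adjointWord w).symm l.rev) = (w.get l).adjoint := by
  have h : ∀ (i : ℕ) (hi : i < (adjointWord w).length), i = w.length - (l + 1) →
      (adjointWord w)[i] = (w.get l).adjoint := by
    intro i hi h
    simp only [adjointWord, List.get_eq_getElem, List.getElem_reverse, List.getElem_map,
      List.length_map]
    congr 2
    omega
  exact h _ _ (Fin.val_rev l)

lemma label_outerEdge (l : Fin w.length) :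
    label ![w, adjointWord w] (outerEdge w l) = (w.get l).adjoint :=
  adjointWord_get w l

section

variable [NeZero w.length]

lemma next_innerEdge (l : Fin w.length) :
    next ![w, adjointWord w] (innerEdge w l) = innerEdge w (l + 1) :=
  congrArg (innerEdge w) (finRotate_apply l)

/-- In the indexing by corresponding letters of `w`, the face of `w^*` is traversed backwards. -/
lemma next_outerEdge (l : Fin w.length) :
    next ![w, adjointWord w] (outerEdge w (l + 1)) = outerEdge w l := by
  have hcast : ∀ {m n : ℕ} (h : m = n) (i : Fin m),
      finRotate n (Fin.cast h i) = Fin.cast h (finRotate m i) := by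
    rintro m _ rfl i
    rfl
  have h : finRotate (adjointWord w).length (Fin.cast (length_adjointWord w).symm (l + 1).rev) =
      Fin.cast (length_adjointWord w).symm l.rev := by
    rw [hcast, finRotate_apply, Fin.rev_add, sub_add_cancel]
  exact congrArg (fun i => (⟨1, i⟩ : Edge ![w, adjointWord w])) h

end

variable {w}

lemma IsAdmissible.apply_innerEdge (hw : IsStarFree w)
    {φ : Equiv.Perm (Edge ![w, adjointWord w])} (hφ : IsAdmissible _ φ) (l : Fin w.length) :
    ∃ m, φ (innerEdge w l) = outerEdge w m := by
  rcases innerEdge_or_outerEdge w (φ (innerEdge w l)) with ⟨m, hm⟩ | h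
  · refine absurd ?_ (hφ.2 (innerEdge w l)).2
    rw [hm, label_innerEdge, label_innerEdge, hw _ (List.get_mem w m), hw _ (List.get_mem w l)]
  · exact h

lemma IsAdmissible.apply_outerEdge (hw : IsStarFree w)
    {φ : Equiv.Perm (Edge ![w, adjointWord w])} (hφ : IsAdmissible _ φ) (l : Fin w.length) :
    ∃ m, φ (outerEdge w l) = innerEdge w m := by
  rcases innerEdge_or_outerEdge w (φ (outerEdge w l)) with h | ⟨m, hm⟩
  · exact h
  · refine absurd ?_ (hφ.2 (outerEdge w l)).2
    rw [hm, label_outerEdge, label_outerEdge, Letter.adjoint, Letter.adjoint,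
      hw _ (List.get_mem w m), hw _ (List.get_mem w l)]

lemma next_fst (e : Edge ![w, adjointWord w]) : (next ![w, adjointWord w] e).1 = e.1 := rfl

/-- This excludes fixed points of both `φ` and `next ∘ φ`, as `next` preserves faces. -/
lemma IsAdmissible.fst_ne (hw : IsStarFree w)
    {φ : Equiv.Perm (Edge ![w, adjointWord w])} (hφ : IsAdmissible _ φ)
    (e : Edge ![w, adjointWord w]) : (φ e).1 ≠ e.1 := by
  rcases innerEdge_or_outerEdge w e with ⟨l, rfl⟩ | ⟨l, rfl⟩
  · obtain ⟨m, hm⟩ := hφ.apply_innerEdge hw l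
    rw [hm]
    simp [innerEdge, outerEdge]
  · obtain ⟨m, hm⟩ := hφ.apply_outerEdge hw l
    rw [hm]
    simp [innerEdge, outerEdge]

variable [NeZero w.length]

/-- An admissible pairing of `w` and `w^*` is spherical if and only if all the vertices of the
glued surface have degree two. -/
lemma IsAdmissible.isSpherical_iff (hw : IsStarFree w)
    {φ : Equiv.Perm (Edge ![w, adjointWord w])} (hφ : IsAdmissible _ φ) :
    IsSpherical _ φ ↔ ∀ e, next _ (φ (next _ (φ e))) = e := by
  have hE : 2 * Nat.card (GluedEdge _ φ) = 2 * w.length :=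
    ((two_mul_card_quot_eq_iff fun e h => hφ.fst_ne hw e (congrArg Sigma.fst h)).2 hφ.1).trans
      (card_edge w)
  -- Vertices are the orbits of `next ∘ φ` on the `2 * w.length` corners. As there are `w.length`
  -- edges and two faces, Euler characteristic two amounts to `V = w.length`.
  have hV : 2 * Nat.card (GluedVertex _ φ) = 2 * w.length ↔
      ∀ e, next _ (φ (next _ (φ e))) = e := by
    rw [← card_edge w]
    refine two_mul_card_quot_eq_iff (g := fun e => next _ (φ e)) fun e h => hφ.fst_ne hw e ?_
    exact (next_fst (φ e)).symm.trans (congrArg Sigma.fst h)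
  have hC : Nat.card (GluedComponent _ φ) = 1 := by
    rw [Nat.card_eq_one_iff_unique]
    obtain ⟨m, hm⟩ := hφ.apply_innerEdge hw 0
    have h01 : (Quot.mk _ 0 : GluedComponent _ φ) = Quot.mk _ 1 :=
      Quot.sound ⟨innerEdge w 0, rfl, by rw [hm]; rfl⟩
    have hall : ∀ x : GluedComponent _ φ, x = Quot.mk _ 0 := by
      rintro ⟨j⟩
      fin_cases j
      · rfl
      · exact h01.symm
    exact ⟨⟨fun x y => (hall x).trans (hall y).symm⟩, ⟨Quot.mk _ 0⟩⟩
  rw [← hV, IsSpherical, eulerChar]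
  simp only [hC, true_and]
  constructor <;> intro h <;> push_cast at * <;> omega

/-- The pairing of `w` and `w^*` given by a rotation. -/
noncomputable def rotationPairing (k : Fin w.length) : Equiv.Perm (Edge ![w, adjointWord w]) :=
  (edgeEquiv w).permCongr
    { toFun := Sum.elim (fun l => Sum.inr (l + k)) (fun l => Sum.inl (l - k))
      invFun := Sum.elim (fun l => Sum.inr (l + k)) (fun l => Sum.inl (l - k))
      left_inv := by rintro (l | l) <;> simp
      right_inv := by rintro (l | l) <;> simp }

lemma rotationPairing_innerEdge (k l : Fin w.length) :
    rotationPairing k (innerEdge w l) = outerEdge w (l + k) := by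
  have h : (edgeEquiv w).symm (innerEdge w l) = Sum.inl l :=
    (edgeEquiv w).symm_apply_eq.2 rfl
  simp only [rotationPairing, Equiv.permCongr_apply, h]
  rfl

lemma rotationPairing_outerEdge (k l : Fin w.length) :
    rotationPairing k (outerEdge w l) = innerEdge w (l - k) := by
  have h : (edgeEquiv w).symm (outerEdge w l) = Sum.inr l :=
    (edgeEquiv w).symm_apply_eq.2 rfl
  simp only [rotationPairing, Equiv.permCongr_apply, h]
  rfl

lemma isAdmissible_rotationPairing (k : Period w.get) :
    IsAdmissible _ (rotationPairing k.1) := by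
  refine ⟨fun e => ?_, fun e => ?_⟩
  · rcases innerEdge_or_outerEdge w e with ⟨l, rfl⟩ | ⟨l, rfl⟩
    · rw [rotationPairing_innerEdge, rotationPairing_outerEdge, add_sub_cancel_right]
    · rw [rotationPairing_outerEdge, rotationPairing_innerEdge, sub_add_cancel]
  · rcases innerEdge_or_outerEdge w e with ⟨l, rfl⟩ | ⟨l, rfl⟩
    · rw [rotationPairing_innerEdge, label_innerEdge, label_outerEdge, k.2]
      simp [Letter.adjoint]
    · rw [rotationPairing_outerEdge, label_innerEdge, label_outerEdge, ← k.2 (l - k.1),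
        sub_add_cancel]
      simp [Letter.adjoint]

lemma next_rotationPairing_sq (k : Fin w.length) (e : Edge ![w, adjointWord w]) :
    next _ (rotationPairing k (next _ (rotationPairing k e))) = e := by
  rcases innerEdge_or_outerEdge w e with ⟨l, rfl⟩ | ⟨l, rfl⟩
  · have h : l + k = (l + k - 1) + 1 := (sub_add_cancel _ _).symm
    rw [rotationPairing_innerEdge, h, next_outerEdge, rotationPairing_outerEdge, next_innerEdge]
    congr 1
    abel
  · have h : l - k + 1 + k = l + 1 := by abel
    rw [rotationPairing_outerEdge, next_innerEdge, rotationPairing_innerEdge, h, next_outerEdge]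

open Fin.CommRing in
-- At a vertex of degree two, the pair formed by inner edge `m` and outer edge `m + k` forces inner
-- edge `m + 1` to be paired with outer edge `m + 1 + k`. The partner of inner edge `0` thus
-- determines the whole pairing.
lemma eq_rotationPairing (hw : IsStarFree w) {φ : Equiv.Perm (Edge ![w, adjointWord w])}
    (hφ : IsAdmissible _ φ) (hs : IsSpherical _ φ) :
    ∃ k : Period w.get, rotationPairing k.1 = φ := by
  rw [hφ.isSpherical_iff hw] at hs
  obtain ⟨k, hk⟩ := hφ.apply_innerEdge hw 0
  have hstep : ∀ m : ℕ, φ (innerEdge w (m : Fin w.length)) = outerEdge w (m + k) := by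
    intro m
    induction m with
    | zero => simpa using hk
    | succ m ih =>
      have h1 : φ (outerEdge w (m + k)) = innerEdge w m := by rw [← ih, hφ.1]
      have h2 := hs (outerEdge w (m + k))
      rw [h1, next_innerEdge, ← next_outerEdge] at h2
      rw [Nat.cast_succ, (next _).injective h2, add_right_comm]
  have hinner : ∀ l, φ (innerEdge w l) = outerEdge w (l + k) := by
    intro l
    simpa using hstep l.val
  have hper : ∀ l, w.get (l + k) = w.get l := by
    intro l
    have h := (hφ.2 (innerEdge w l)).1
    rw [hinner, label_innerEdge, label_outerEdge] at h
    exact (hw.get_eq_iff _ _).2 h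
  refine ⟨⟨k, hper⟩, Equiv.ext fun e => ?_⟩
  rcases innerEdge_or_outerEdge w e with ⟨l, rfl⟩ | ⟨l, rfl⟩
  · rw [rotationPairing_innerEdge, hinner]
  · have h := hφ.1 (innerEdge w (l - k))
    rw [hinner, sub_add_cancel] at h
    rw [rotationPairing_outerEdge, h]

lemma bCount_eq_card_period (hw : IsStarFree w) : bCount w = Nat.card (Period w.get) := by
  refine (Nat.card_congr (Equiv.ofBijective (fun k : Period w.get =>
    (⟨rotationPairing k.1, isAdmissible_rotationPairing k,
      ((isAdmissible_rotationPairing k).isSpherical_iff hw).2 (next_rotationPairing_sq k.1)⟩ :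
      {φ : Equiv.Perm (Edge ![w, adjointWord w]) // IsAdmissible _ φ ∧ IsSpherical _ φ}))
    ⟨fun k k' h => ?_, fun φ => ?_⟩)).symm
  · have h1 := congrArg (fun φ => φ.1 (innerEdge w 0)) h
    simp only [rotationPairing_innerEdge, zero_add] at h1
    exact Subtype.ext (outerEdge_injective w h1)
  · obtain ⟨k, hk⟩ := eq_rotationPairing hw φ.2.1 φ.2.2
    exact ⟨k, Subtype.ext hk⟩

end TwoFaces

lemma aCount_eq_zero {w : StarWord} (hne : w ≠ []) (hw : IsStarFree w) : aCount w = 0 :=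
  numSpherical_eq_zero_of_isStarFree ![w] ⟨0, ⟨0, List.length_pos_iff.2 hne⟩⟩ fun j => by
    fin_cases j
    exact hw

lemma cCount_eq_zero {w : StarWord} (hne : w ≠ []) (hw : IsStarFree w) : cCount w = 0 :=
  numSpherical_eq_zero_of_isStarFree ![w, w] ⟨0, ⟨0, List.length_pos_iff.2 hne⟩⟩ fun j => by
    fin_cases j <;> exact hw

lemma bCount_eq_coperiod {w : StarWord} (hne : w ≠ []) (hw : IsStarFree w) :
    bCount w = coperiod w := by
  have : NeZero w.length := ⟨by simpa using hne⟩
  rw [bCount_eq_card_period hw, card_period_get hne]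

end GinibreWords

theorem mainTheorem10 (w : GinibreWords.StarWord) (hne : w ≠ [])
    (hw : GinibreWords.IsStarFree w) :
    (∀ {Ω : ℕ → Type*} [∀ N, MeasurableSpace (Ω N)]
        (P : (N : ℕ) → Measure (Ω N)) [∀ N, IsProbabilityMeasure (P N)]
        (G : (N : ℕ) → ℕ → Ω N → Matrix (Fin N) (Fin N) ℂ),
        (∀ N, GinibreWords.IsGinibreSequence (G N) (P N)) →
        TendstoInDistribution
          (fun N (ω : Ω N) => (GinibreWords.wordMatrix (fun r => G N r ω) w).trace)
          atTop (id : ℂ → ℂ) P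
          (GinibreWords.complexGaussian (GinibreWords.coperiod w : ℝ≥0))) ∧
      GinibreWords.aCount w = 0 ∧
      GinibreWords.cCount w = 0 ∧
      GinibreWords.bCount w = GinibreWords.coperiod w := by
  exact ⟨fun P _ G hG => GinibreWords.tendstoInDistribution_trace w hne hw P G hG,
    GinibreWords.aCount_eq_zero hne hw, GinibreWords.cCount_eq_zero hne hw,
    GinibreWords.bCount_eq_coperiod hne hw⟩
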